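/- Let $n \ge k \ge 2$ be integers. The game NecklaceNim $NN(n,k)$ is played on $n$ stacks of tokens placed on the vertices $1,\dots,n$ of a path; a position is a vector $p=(p_1,\dots,p_n)$ of nonnegative integers. A move consists of choosing one of the sets $\{i,i+1,\dots,i+k-1\}$ with $1\le i\le n-k+1$, or the set $\{1,n\}$, and removing tokens from the stacks in the chosen set, at least one token in total (and possibly none from some of its stacks). Two players alternate, and the last player to move wins. A $\mathcal P$-position is a position from which the player who has just moved (the previous player) has a winning strategy; equivalently, a position none of whose options is a $\mathcal P$-position. Let $n\ge 3$, $\ell=\lfloor n/2\rfloor$ and $k=\lceil n/2\rceil$; that is, consider the games $NN(2\ell,\ell)$ with $\ell\ge 2$ and $NN(2\ell+1,\ell+1)$ with $\ell\ge 1$. For $2\le i\le \ell+1$ put $s_i=p_i+p_{i+1}+\dots+p_{i+k-2}$. Then the set of $\mathcal P$-positions of $NN(n,k)$ is $$\Bigl\{p \;\Bigm|\; p_1+\dots+p_{\lfloor n/2\rfloor}=p_{\lceil n/2\rceil+1}+\dots+p_n \ \text{ and }\ \min(p_1,p_n)=\min_{2\le i\le \ell+1} s_i\Bigr\}.$$ 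-/

import Mathlib

/-- A position of a game on `n` stacks of tokens arranged on a path. The stacks
`p_1, …, p_n` are `p 0, …, p (n - 1)`: the vertex `v : Fin n` carries the label `v + 1`. -/
abbrev Position (n : ℕ) : Type := Fin n → ℕ

/-- A legal move of the game SetNim with collection `𝒜` of move sets: choose a set `A ∈ 𝒜` and
remove, in total, at least one token from the stacks in `A`, leaving all other stacks unchanged. -/
def SetNimMove {n : ℕ} (𝒜 : Set (Finset (Fin n))) (p q : Position n) : Prop :=
  ∃ A ∈ 𝒜, (∀ v, q v ≤ p v) ∧ (∀ v, v ∉ A → q v = p v) ∧ ∃ v, q v < p v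

theorem SetNimMove.sum_lt {n : ℕ} {𝒜 : Set (Finset (Fin n))} {p q : Position n}
    (h : SetNimMove 𝒜 p q) : ∑ v, q v < ∑ v, p v := by
  obtain ⟨A, _, hle, _, v, hv⟩ := h
  exact Finset.sum_lt_sum (fun w _ => hle w) ⟨v, Finset.mem_univ v, hv⟩

/-- The 𝒫-positions of SetNim under normal play (the last player to move wins): a position is
a 𝒫-position if and only if none of its options is a 𝒫-position. The recursion is well-founded
because each move lowers the total number of tokens. -/
def IsPPosition {n : ℕ} (𝒜 : Set (Finset (Fin n))) (p : Position n) : Prop :=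
  ∀ q : Position n, SetNimMove 𝒜 p q → ¬ IsPPosition 𝒜 q
termination_by ∑ v, p v
decreasing_by exact SetNimMove.sum_lt (by assumption)

/-- The set of vertices with labels `a, a + 1, …, b`. -/
def pathSegment (n a b : ℕ) : Finset (Fin n) :=
  Finset.univ.filter fun v => a ≤ (v : ℕ) + 1 ∧ (v : ℕ) + 1 ≤ b

/-- The set consisting of the two end vertices, labelled `1` and `n`. -/
def endVertices (n : ℕ) : Finset (Fin n) :=
  Finset.univ.filter fun v => (v : ℕ) + 1 = 1 ∨ (v : ℕ) + 1 = n

/-- The move sets of NecklaceNim `NN(n, k)`: the sets `{i, …, i + k - 1}` of `k` consecutive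
vertices, `i = 1, …, n - k + 1`, and the set `{1, n}`. -/
def necklaceNim (n k : ℕ) : Set (Finset (Fin n)) :=
  {A | ∃ i : ℕ, 1 ≤ i ∧ i + k ≤ n + 1 ∧ A = pathSegment n i (i + k - 1)} ∪ {endVertices n}

/-- The sum `p_a + p_{a+1} + … + p_b`. -/
def segmentSum {n : ℕ} (p : Position n) (a b : ℕ) : ℕ :=
  ∑ v ∈ pathSegment n a b, p v

/-- The first end stack `p_1`. -/
def firstStack {n : ℕ} (hn : 3 ≤ n) (p : Position n) : ℕ := p ⟨0, by omega⟩

/-- The last end stack `p_n`. -/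
def lastStack {n : ℕ} (hn : 3 ≤ n) (p : Position n) : ℕ := p ⟨n - 1, by omega⟩

theorem windowIndices_nonempty {n ℓ : ℕ} (hn : 3 ≤ n) (hℓ : ℓ = n / 2) :
    (Finset.Icc 2 (ℓ + 1)).Nonempty := by
  rw [Finset.nonempty_Icc]
  omega

/-!
Cut the path into its first `ℓ` and its last `ℓ` stacks, with everything between them lumped into
a middle part, which every segment of the game contains. Reflecting the path swaps the two rows.

No move joins two positions of the claimed set: a segment leaves out one stack less than a window
`s_i` does, so it contains the part of the window in one of the two rows. If the minimum window
does not shrink, that part is unchanged, and equality of the row sums then leaves no token to take.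

To reach the set from any other position, say with at least as many tokens in the left row, first
remove the surplus of that row, `s` tokens from its inner end and the others from its end stack.
If for the least possible `s` some window is already below both ends, a move on the ends alone
reaches the set. Otherwise let `s` grow. When a window first falls below the smaller end, the step
has overshot by at most two, which moving one token back to the end stack repairs. When this never
happens, all the surplus that can be is taken from the inner end, and the rest of the work is done
by the segment given by the stack at which the two rows cross: remove tokens from it in pairs, one
from each row, until the smallest window has come down to the smaller end, or until both rows are
empty inside the segment and the middle part can be lowered to that value.
-/

open Finset Function

section TailSum

variable {ℓ : ℕ} {f g : Fin ℓ → ℕ} {s t : ℕ}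

/-- The number of tokens in the stacks `t, t + 1, …, ℓ - 1` of a row of `ℓ` stacks. -/
def tailSum (f : Fin ℓ → ℕ) (t : ℕ) : ℕ := ∑ x with t ≤ x.val, f x

theorem tailSum_of_le (f : Fin ℓ → ℕ) (h : ℓ ≤ t) : tailSum f t = 0 :=
  sum_eq_zero fun x hx => absurd (mem_filter.1 hx).2 (by omega)

theorem tailSum_eq_add (f : Fin ℓ → ℕ) (x : Fin ℓ) : tailSum f x = f x + tailSum f (x + 1) := by
  have hins : univ.filter (fun y : Fin ℓ => x.val ≤ y) =
      insert x (univ.filter fun y : Fin ℓ => x.val + 1 ≤ y) := by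
    ext y
    simp only [mem_filter, mem_univ, true_and, mem_insert, Fin.ext_iff]
    omega
  rw [tailSum, hins, sum_insert (by simp), tailSum]

theorem tailSum_zero [NeZero ℓ] (f : Fin ℓ → ℕ) : tailSum f 0 = f 0 + tailSum f 1 := by
  simpa only [Fin.val_zero] using tailSum_eq_add f 0

theorem tailSum_antitone (f : Fin ℓ → ℕ) : Antitone (tailSum f) := fun _ _ hst =>
  sum_le_sum_of_subset (monotone_filter_right _ fun _ _ hx => hst.trans hx)

theorem tailSum_eq_zero (h : tailSum f 0 = 0) (t : ℕ) : tailSum f t = 0 :=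
  Nat.le_zero.1 (h ▸ tailSum_antitone f t.zero_le)

theorem tailSum_le_tailSum (h : f ≤ g) (t : ℕ) : tailSum f t ≤ tailSum g t :=
  sum_le_sum fun x _ => h x

theorem tailSum_congr (h : ∀ x : Fin ℓ, t ≤ x → f x = g x) : tailSum f t = tailSum g t :=
  sum_congr rfl fun x hx => h x (mem_filter.1 hx).2

theorem tailSum_add_tailSum_eq (h : ∀ x : Fin ℓ, x < t → f x = g x) (hst : s ≤ t) :
    tailSum f s + tailSum g t = tailSum g s + tailSum f t := by
  have hsplit (f : Fin ℓ → ℕ) :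
      tailSum f s = ∑ x : Fin ℓ with s ≤ x.val ∧ x.val < t, f x + tailSum f t := by
    rw [tailSum, ← sum_filter_add_sum_filter_not _ (fun x : Fin ℓ => x.val < t), filter_filter,
      filter_filter, tailSum]
    congr 2
    ext x
    simp only [mem_filter, mem_univ, true_and]
    omega
  have heq := sum_congr (rfl : univ.filter (fun x : Fin ℓ => s ≤ x.val ∧ x.val < t) = _)
    fun x hx => h x (mem_filter.1 hx).2.2
  rw [hsplit f, hsplit g, heq]
  exact Nat.add_right_comm ..

theorem eq_of_tailSum_eq (hle : f ≤ g) (h : ∀ x : Fin ℓ, x < t → f x = g x)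
    (ht : tailSum f t = tailSum g t) : f = g := by
  funext x
  rcases lt_or_ge x.val t with hx | hx
  · exact h x hx
  · exact (sum_eq_sum_iff_of_le fun y _ => hle y).1 ht x (by simpa using hx)

theorem exists_first_pos (h : 0 < tailSum f t) :
    ∃ x : Fin ℓ, t ≤ x ∧ 0 < f x ∧ tailSum f x = tailSum f t := by
  have hex : ∃ x : Fin ℓ, t ≤ x ∧ 0 < f x := by
    obtain ⟨x, hx, hfx⟩ := exists_ne_zero_of_sum_ne_zero h.ne'
    exact ⟨x, (mem_filter.1 hx).2, Nat.pos_of_ne_zero hfx⟩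
  obtain ⟨x, ⟨htx, hfx⟩, hmin⟩ :=
    ({x | t ≤ x.val ∧ 0 < f x} : Set (Fin ℓ)).toFinite.exists_minimal hex
  refine ⟨x, htx, hfx, sum_subset (fun y hy => ?_) fun y hy hyx => ?_⟩
  · simp only [mem_filter, mem_univ, true_and] at hy ⊢
    omega
  · simp only [mem_filter, mem_univ, true_and, not_le] at hy hyx
    by_contra hne
    exact absurd (hmin ⟨hy, Nat.pos_of_ne_zero hne⟩ hyx.le) (not_le.2 hyx)

theorem tailSum_update (f : Fin ℓ → ℕ) (x : Fin ℓ) (a t : ℕ) :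
    tailSum (update f x a) t + (if t ≤ x then f x else 0) =
      tailSum f t + (if t ≤ x then a else 0) := by
  split_ifs with h
  · have hx : x ∈ ({y | t ≤ y.val} : Finset (Fin ℓ)) := by simpa using h
    rw [tailSum, sum_update_of_mem hx, tailSum, ← add_sum_erase _ f hx, sdiff_singleton_eq_erase]
    omega
  · rw [tailSum, sum_update_of_notMem (by simpa using h), tailSum]

/-- The row `f` with one token taken from stack `x`, if there is one. -/
def removeToken (f : Fin ℓ → ℕ) (x : Fin ℓ) : Fin ℓ → ℕ := update f x (f x - 1)

theorem removeToken_self (f : Fin ℓ → ℕ) (x : Fin ℓ) : removeToken f x x = f x - 1 :=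
  update_self ..

theorem removeToken_of_ne {x y : Fin ℓ} (h : y ≠ x) (f : Fin ℓ → ℕ) : removeToken f x y = f y :=
  update_of_ne h ..

theorem removeToken_le (f : Fin ℓ → ℕ) (x : Fin ℓ) : removeToken f x ≤ f :=
  update_le_self_iff.2 (Nat.sub_le ..)

theorem tailSum_removeToken {x : Fin ℓ} (h : 0 < f x) (t : ℕ) :
    tailSum (removeToken f x) t + (if t ≤ x then 1 else 0) = tailSum f t := by
  have := tailSum_update f x (f x - 1) t
  rw [removeToken]
  split_ifs at this ⊢ <;> omega

theorem tailSum_removeToken_of_le {x : Fin ℓ} (h : 0 < f x) (ht : t ≤ x) :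
    tailSum (removeToken f x) t + 1 = tailSum f t := by
  rw [← tailSum_removeToken h t, if_pos ht]

theorem tailSum_removeToken_of_lt {x : Fin ℓ} (f : Fin ℓ → ℕ) (ht : x < t) :
    tailSum (removeToken f x) t = tailSum f t :=
  tailSum_congr fun _ hy => removeToken_of_ne (Fin.ne_of_gt (ht.trans_le hy)) f

/-- The row `f` with `s` tokens taken from its far end, emptying stack `ℓ - 1` first. -/
def trimEnd (f : Fin ℓ → ℕ) (s : ℕ) (x : Fin ℓ) : ℕ :=
  (tailSum f x - s) - (tailSum f (x + 1) - s)

theorem trimEnd_le (f : Fin ℓ → ℕ) (s : ℕ) : trimEnd f s ≤ f := fun x => by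
  have := tailSum_eq_add f x
  change (tailSum f x - s) - (tailSum f (x + 1) - s) ≤ f x
  omega

theorem trimEnd_eq {x : Fin ℓ} (h : s ≤ tailSum f (x + 1)) : trimEnd f s x = f x := by
  have := tailSum_eq_add f x
  rw [trimEnd]
  omega

theorem tailSum_trimEnd (f : Fin ℓ → ℕ) (s t : ℕ) :
    tailSum (trimEnd f s) t = tailSum f t - s := by
  rcases le_total ℓ t with h | h
  · rw [tailSum_of_le _ h, tailSum_of_le _ h, Nat.zero_sub]
  induction h using Nat.decreasingInduction with
  | self => rw [tailSum_of_le _ le_rfl, tailSum_of_le _ le_rfl, Nat.zero_sub]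
  | of_succ t ht ih =>
    have hanti := tailSum_antitone f (Nat.le_add_right t 1)
    have hadd := tailSum_eq_add (trimEnd f s) ⟨t, ht⟩
    simp only [ih, trimEnd] at hadd
    omega

/-- The rows `f` and `g`, counted from opposite ends of the path, cross at stack `i` of `f`: the
number of tokens of `f` beyond stack `i` lies between those of `g` beyond stack `i.rev` and from
stack `i.rev` on, and if it is positive then so is stack `i.rev` of `g`. -/
structure Crosses (f g : Fin ℓ → ℕ) (i : Fin ℓ) : Prop where
  tailSum_succ_le : tailSum g (i.rev + 1) ≤ tailSum f (i + 1)
  le_tailSum : tailSum f (i + 1) ≤ tailSum g i.rev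
  pos_or_eq_zero : 0 < g i.rev ∨ tailSum f (i + 1) = 0

theorem Crosses.removeToken_of_lt {i x y : Fin ℓ} (h : Crosses f g i) (hx : 0 < f x) (hix : i < x)
    (hy : 0 < g y) (hiy : i.rev < y) : Crosses (removeToken f x) (removeToken g y) i := by
  obtain ⟨hle, hge, hpos⟩ := h
  have hf := tailSum_removeToken_of_le (t := i + 1) hx hix
  have hg := tailSum_removeToken_of_le (t := i.rev + 1) hy hiy
  have hg' := tailSum_removeToken_of_le hy hiy.le
  refine ⟨?_, ?_, removeToken_of_ne hiy.ne g ▸ ?_⟩ <;> omega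

theorem Crosses.removeToken_rev {i x : Fin ℓ} (h : Crosses f g i) (hx : 0 < f x) (hix : i < x)
    (hi : 0 < g i.rev) (hzero : tailSum g (i.rev + 1) = 0) :
    Crosses (removeToken f x) (removeToken g i.rev) i := by
  obtain ⟨-, hge, -⟩ := h
  have hf := tailSum_removeToken_of_le (t := i + 1) hx hix
  have hg := tailSum_removeToken_of_le hi le_rfl
  have hg' := tailSum_removeToken_of_lt g (Nat.lt_add_one i.rev)
  have hadd := tailSum_eq_add g i.rev
  have hself := removeToken_self g i.rev
  exact ⟨by omega, by omega, by omega⟩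

variable [NeZero ℓ] {δ : ℕ}

theorem exists_crosses (h : tailSum f 0 = tailSum g 0) :
    ∃ i : Fin ℓ, Crosses f g i ∨ Crosses g f i.rev := by
  have hℓ : tailSum f ℓ ≤ tailSum g (ℓ - ℓ) := (tailSum_of_le f le_rfl).trans_le (Nat.zero_le _)
  have hex : ∃ t, tailSum f t ≤ tailSum g (ℓ - t) := ⟨ℓ, hℓ⟩
  have hfind := Nat.find_spec hex
  have hmin := @Nat.find_min _ _ hex
  have hle := Nat.find_min' hex hℓ
  generalize Nat.find hex = t at *
  rcases t with _ | t
  · have hf : tailSum f 0 = 0 := by rwa [Nat.sub_zero, tailSum_of_le g le_rfl, Nat.le_zero] at hfind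
    have hg : tailSum g ((0 : Fin ℓ).rev + 1) = 0 := tailSum_eq_zero (h ▸ hf) _
    exact ⟨0, .inl ⟨hg.trans_le (Nat.zero_le _), (tailSum_eq_zero hf _).trans_le (Nat.zero_le _),
      .inr (tailSum_eq_zero hf _)⟩⟩
  obtain ⟨i, rfl⟩ : ∃ i : Fin ℓ, i.val = t := ⟨⟨t, hle⟩, rfl⟩
  have hprev := hmin (Nat.lt_succ_self _)
  rw [show ℓ - (i + 1) = i.rev by rw [Fin.val_rev]] at hfind
  rw [show ℓ - i = i.rev + 1 by rw [Fin.val_rev]; omega] at hprev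
  have hf := tailSum_eq_add f i
  have hg := tailSum_eq_add g i.rev
  by_cases hcross : Crosses f g i
  · exact ⟨i, .inl hcross⟩
  have hle : tailSum f (i + 1) ≤ tailSum g (i.rev + 1) := by
    contrapose! hcross
    exact ⟨hcross.le, hfind, .inl (by omega)⟩
  refine ⟨i, .inr ⟨?_, ?_, ?_⟩⟩ <;> rw [Fin.rev_rev] <;> omega

theorem tailSum_succ_congr (h : ∀ x ≠ 0, f x = g x) (t : ℕ) :
    tailSum f (t + 1) = tailSum g (t + 1) :=
  tailSum_congr fun x hx => h x (Fin.pos_iff_ne_zero.1 (Fin.lt_def.2 (Nat.zero_lt_of_lt hx)))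

/-- The row `f` with one token moved from stack `z` to stack `0`, if stack `z` is nonempty and
not stack `0`. -/
def shiftToZero (f : Fin ℓ → ℕ) (z : Fin ℓ) : Fin ℓ → ℕ := update (removeToken f z) 0 (f 0 + 1)

theorem shiftToZero_zero (f : Fin ℓ → ℕ) (z : Fin ℓ) : shiftToZero f z 0 = f 0 + 1 :=
  update_self ..

theorem shiftToZero_le (f : Fin ℓ → ℕ) (z : Fin ℓ) {x : Fin ℓ} (hx : x ≠ 0) :
    shiftToZero f z x ≤ f x := by
  rw [shiftToZero, update_of_ne hx]
  exact removeToken_le f z x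

theorem tailSum_succ_shiftToZero {z : Fin ℓ} (h : 0 < f z) (t : ℕ) :
    tailSum (shiftToZero f z) (t + 1) + (if t + 1 ≤ z then 1 else 0) = tailSum f (t + 1) := by
  rw [← tailSum_removeToken h, tailSum_succ_congr fun x hx => update_of_ne hx ..]

theorem tailSum_shiftToZero_zero {z : Fin ℓ} (h : 0 < f z) (hz : 1 ≤ z.val) :
    tailSum (shiftToZero f z) 0 = tailSum f 0 := by
  have htail := tailSum_succ_shiftToZero h 0
  rw [if_pos hz, zero_add] at htail
  rw [tailSum_zero, tailSum_zero, shiftToZero_zero, ← htail]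
  omega

/-- The row `f` with `δ` tokens taken from it: `s` of them from its far end and the other
`δ - s` from stack `0`. -/
def trimBoth (f : Fin ℓ → ℕ) (δ s : ℕ) : Fin ℓ → ℕ := update (trimEnd f s) 0 (f 0 - (δ - s))

theorem trimBoth_zero (f : Fin ℓ → ℕ) (δ s : ℕ) : trimBoth f δ s 0 = f 0 - (δ - s) :=
  update_self ..

theorem trimBoth_of_ne (f : Fin ℓ → ℕ) (δ s : ℕ) {x : Fin ℓ} (hx : x ≠ 0) :
    trimBoth f δ s x = trimEnd f s x :=
  update_of_ne hx ..

theorem trimBoth_le (f : Fin ℓ → ℕ) (δ s : ℕ) : trimBoth f δ s ≤ f :=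
  update_le_iff.2 ⟨Nat.sub_le .., fun x _ => trimEnd_le f s x⟩

theorem trimBoth_eq (hδ : δ ≤ s) (h : s < tailSum f t) {x : Fin ℓ} (hx : x < t) :
    trimBoth f δ s x = f x := by
  rcases eq_or_ne x 0 with rfl | hx0
  · rw [trimBoth_zero]
    omega
  · rw [trimBoth_of_ne f δ s hx0, trimEnd_eq]
    exact h.le.trans (tailSum_antitone f hx)

theorem tailSum_trimBoth (f : Fin ℓ → ℕ) (δ s : ℕ) (ht : 0 < t) :
    tailSum (trimBoth f δ s) t = tailSum f t - s := by
  obtain ⟨t, rfl⟩ := Nat.exists_eq_succ_of_ne_zero ht.ne'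
  rw [← tailSum_trimEnd]
  exact tailSum_succ_congr (fun _ => trimBoth_of_ne f δ s) t

theorem tailSum_trimBoth_zero (hδ : s ≤ δ) (h0 : δ - s ≤ f 0) (h1 : s ≤ tailSum f 1) :
    tailSum (trimBoth f δ s) 0 + δ = tailSum f 0 := by
  rw [tailSum_zero, tailSum_zero, trimBoth_zero, tailSum_trimBoth f δ s one_pos]
  omega

end TailSum

/-- A position cut into two rows of `ℓ` outer stacks and a middle part, of which only the total
`mid` matters because every segment of the game contains it. In both rows, stack `x` is the one
at distance `x` from the end of the path, so that reflecting the path swaps the rows. -/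
@[ext]
structure HalvedPosition (ℓ : ℕ) where
  /-- The row that starts at the first end of the path. -/
  left : Fin ℓ → ℕ
  /-- The number of tokens between the two rows. -/
  mid : ℕ
  /-- The row that starts at the last end of the path. -/
  right : Fin ℓ → ℕ

namespace HalvedPosition

variable {ℓ i j : ℕ} {P Q R : HalvedPosition ℓ}

/-- The reflected position. -/
def swap (P : HalvedPosition ℓ) : HalvedPosition ℓ := ⟨P.right, P.mid, P.left⟩

/-- The sum `s_{i+2}` of the paper. It leaves out the `i + 1` outermost stacks of the left row and
the `ℓ - i` outermost stacks of the right row, one stack more than a segment of the game does. -/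
def window (P : HalvedPosition ℓ) (i : Fin ℓ) : ℕ :=
  P.mid + tailSum P.left (i + 1) + tailSum P.right (i.rev + 1)

theorem window_swap (P : HalvedPosition ℓ) (i : Fin ℓ) : P.swap.window i = P.window i.rev := by
  rw [window, window, Fin.rev_rev, Nat.add_right_comm, swap]

/-- Removal of tokens from the segment that leaves out the `i` outermost stacks of the left row
and the `j` outermost stacks of the right row; in the game `i + j = ℓ`. -/
structure SegmentMove (i j : ℕ) (P Q : HalvedPosition ℓ) : Prop where
  left_le : Q.left ≤ P.left
  mid_le : Q.mid ≤ P.mid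
  right_le : Q.right ≤ P.right
  left_eq : ∀ x : Fin ℓ, x < i → Q.left x = P.left x
  right_eq : ∀ x : Fin ℓ, x < j → Q.right x = P.right x

namespace SegmentMove

theorem refl (i j : ℕ) (P : HalvedPosition ℓ) : SegmentMove i j P P :=
  ⟨le_rfl, le_rfl, le_rfl, fun _ _ => rfl, fun _ _ => rfl⟩

theorem trans (hPQ : SegmentMove i j P Q) (hQR : SegmentMove i j Q R) : SegmentMove i j P R :=
  ⟨hQR.left_le.trans hPQ.left_le, hQR.mid_le.trans hPQ.mid_le, hQR.right_le.trans hPQ.right_le,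
    fun x hx => (hQR.left_eq x hx).trans (hPQ.left_eq x hx),
    fun x hx => (hQR.right_eq x hx).trans (hPQ.right_eq x hx)⟩

theorem swap (h : SegmentMove i j P Q) : SegmentMove j i P.swap Q.swap :=
  ⟨h.right_le, h.mid_le, h.left_le, h.right_eq, h.left_eq⟩

theorem rows_eq_of_tailSum_eq (h : SegmentMove i j P Q)
    (hP : tailSum P.left 0 = tailSum P.right 0) (hQ : tailSum Q.left 0 = tailSum Q.right 0)
    (htail : tailSum Q.left i = tailSum P.left i ∨ tailSum Q.right j = tailSum P.right j) :
    Q.left = P.left ∧ Q.right = P.right := by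
  have hleft := tailSum_add_tailSum_eq h.left_eq i.zero_le
  have hright := tailSum_add_tailSum_eq h.right_eq j.zero_le
  exact ⟨eq_of_tailSum_eq h.left_le h.left_eq (by omega),
    eq_of_tailSum_eq h.right_le h.right_eq (by omega)⟩

end SegmentMove

section RemovePair

variable {i x y : Fin ℓ}

/-- The position `P` with one token taken from stack `x` on the left and one from stack `y` on the
right, if these are nonempty. -/
def removePair (P : HalvedPosition ℓ) (x y : Fin ℓ) : HalvedPosition ℓ :=
  ⟨removeToken P.left x, P.mid, removeToken P.right y⟩

theorem window_removePair (hx : 0 < P.left x) (hy : 0 < P.right y) (t : Fin ℓ) :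
    (P.removePair x y).window t + (if t + 1 ≤ x.val then 1 else 0) +
      (if t.rev + 1 ≤ y.val then 1 else 0) = P.window t := by
  rw [window, window, ← tailSum_removeToken hx, ← tailSum_removeToken hy]
  simp only [removePair]
  omega

theorem sum_eq_removePair (hsum : tailSum P.left 0 = tailSum P.right 0) (hx : 0 < P.left x)
    (hy : 0 < P.right y) :
    tailSum (P.removePair x y).left 0 = tailSum (P.removePair x y).right 0 := by
  have hleft := tailSum_removeToken_of_le hx (Nat.zero_le _)
  have hright := tailSum_removeToken_of_le hy (Nat.zero_le _)
  simp only [removePair]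
  omega

theorem segmentMove_removePair {i j : ℕ} (hx : i ≤ x) (hy : j ≤ y) :
    SegmentMove i j P (P.removePair x y) :=
  ⟨removeToken_le P.left x, le_rfl, removeToken_le P.right y,
    fun _ hz => removeToken_of_ne (Fin.ne_of_lt (hz.trans_le hx)) _,
    fun _ hz => removeToken_of_ne (Fin.ne_of_lt (hz.trans_le hy)) _⟩

theorem le_window_removePair_rev {m : ℕ} (hlt : ∀ t, m < P.window t)
    (hx : 0 < P.left x) (hxi : tailSum P.left x = tailSum P.left (i + 1))
    (hi : 0 < P.right i.rev) (t : Fin ℓ) : m ≤ (P.removePair x i.rev).window t := by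
  have hwindow := window_removePair hx hi t
  by_cases hboth : t + 1 ≤ x.val ∧ t.rev + 1 ≤ i.rev.val
  · -- Window `t` exceeds window `i` by at least the stack `i.rev` of the right row.
    have hleft : tailSum P.left x ≤ tailSum P.left (t + 1) := tailSum_antitone _ hboth.1
    have hright : tailSum P.right i.rev ≤ tailSum P.right (t.rev + 1) := tailSum_antitone _ hboth.2
    have hadd := tailSum_eq_add P.right i.rev
    have hlti := hlt i
    rw [if_pos hboth.1, if_pos hboth.2] at hwindow
    rw [window] at hlti
    have hge : P.window i + P.right i.rev ≤ P.window t := by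
      rw [window, window]
      omega
    rw [window] at hge
    omega
  · have := hlt t
    split_ifs at hwindow <;> omega

end RemovePair

variable [NeZero ℓ]

/-- Removal of tokens from the two end stacks of the path. -/
structure EndMove (P Q : HalvedPosition ℓ) : Prop where
  left_le : Q.left ≤ P.left
  mid_eq : Q.mid = P.mid
  right_le : Q.right ≤ P.right
  left_eq : ∀ x ≠ 0, Q.left x = P.left x
  right_eq : ∀ x ≠ 0, Q.right x = P.right x

theorem EndMove.swap (h : EndMove P Q) : EndMove P.swap Q.swap :=
  ⟨h.right_le, h.mid_eq, h.left_le, h.right_eq, h.left_eq⟩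

/-- A move of the game, or the removal of no token at all. -/
def Move (P Q : HalvedPosition ℓ) : Prop :=
  (∃ i j, i + j = ℓ ∧ SegmentMove i j P Q) ∨ EndMove P Q

theorem Move.left_le : Move P Q → Q.left ≤ P.left
  | .inl ⟨_, _, _, h⟩ => h.left_le
  | .inr h => h.left_le

theorem Move.mid_le : Move P Q → Q.mid ≤ P.mid
  | .inl ⟨_, _, _, h⟩ => h.mid_le
  | .inr h => h.mid_eq.le

theorem Move.right_le : Move P Q → Q.right ≤ P.right
  | .inl ⟨_, _, _, h⟩ => h.right_le
  | .inr h => h.right_le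

theorem Move.swap : Move P Q → Move P.swap Q.swap
  | .inl ⟨i, j, hij, h⟩ => .inl ⟨j, i, by omega, h.swap⟩
  | .inr h => .inr h.swap

/-- The smaller of the two end stacks. -/
def minEnd (P : HalvedPosition ℓ) : ℕ := min (P.left 0) (P.right 0)

theorem minEnd_swap (P : HalvedPosition ℓ) : P.swap.minEnd = P.minEnd := min_comm ..

/-- The claimed 𝒫-positions: both rows hold equally many tokens, and the smaller end stack is
the least window. -/
structure IsBalanced (P : HalvedPosition ℓ) : Prop where
  sum_eq : tailSum P.left 0 = tailSum P.right 0
  isLeast : IsLeast (Set.range P.window) P.minEnd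

/-- Balanced, except that the smaller end stack may lie below all windows. -/
structure IsAdmissible (P : HalvedPosition ℓ) : Prop where
  sum_eq : tailSum P.left 0 = tailSum P.right 0
  le_window : ∀ t, P.minEnd ≤ P.window t

theorem IsAdmissible.swap (h : P.IsAdmissible) : P.swap.IsAdmissible :=
  ⟨h.sum_eq.symm, fun t => by rw [minEnd_swap, window_swap]; exact h.le_window _⟩

theorem IsAdmissible.isBalanced {i : Fin ℓ} (h : P.IsAdmissible) (hi : P.window i ≤ P.minEnd) :
    P.IsBalanced :=
  ⟨h.sum_eq, ⟨i, hi.antisymm (h.le_window i)⟩, Set.forall_mem_range.2 h.le_window⟩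

theorem IsBalanced.isAdmissible (h : P.IsBalanced) : P.IsAdmissible :=
  ⟨h.sum_eq, Set.forall_mem_range.1 h.isLeast.2⟩

theorem IsBalanced.swap (h : P.IsBalanced) : P.swap.IsBalanced := by
  obtain ⟨i, hi⟩ := h.isLeast.1
  refine h.isAdmissible.swap.isBalanced (i := i.rev) ?_
  rw [minEnd_swap, window_swap, Fin.rev_rev, hi]

section NoMove

theorem SegmentMove.minEnd_eq (h : SegmentMove i j P Q) (hij : i + j = ℓ)
    (hP : tailSum P.left 0 = tailSum P.right 0) (hQ : tailSum Q.left 0 = tailSum Q.right 0) :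
    Q.minEnd = P.minEnd := by
  suffices hends : Q.left 0 = P.left 0 ∧ Q.right 0 = P.right 0 by
    rw [minEnd, minEnd, hends.1, hends.2]
  by_cases hpos : 0 < i ∧ 0 < j
  · exact ⟨h.left_eq 0 hpos.1, h.right_eq 0 hpos.2⟩
  have htail : tailSum Q.left i = tailSum P.left i ∨ tailSum Q.right j = tailSum P.right j := by
    rcases Nat.eq_zero_or_pos j with rfl | hj
    · exact .inl (by rw [tailSum_of_le _ (by omega), tailSum_of_le _ (by omega)])
    · exact .inr (by rw [tailSum_of_le _ (by omega), tailSum_of_le _ (by omega)])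
  obtain ⟨hleft, hright⟩ := h.rows_eq_of_tailSum_eq hP hQ htail
  exact ⟨congrFun hleft 0, congrFun hright 0⟩

theorem SegmentMove.eq_of_isBalanced (h : SegmentMove i j P Q) (hij : i + j = ℓ)
    (hP : P.IsBalanced) (hQ : Q.IsBalanced) : Q = P := by
  obtain ⟨w, hw⟩ := hP.isLeast.1
  have hge : P.window w ≤ Q.window w := by
    rw [hw, ← h.minEnd_eq hij hP.sum_eq hQ.sum_eq]
    exact hQ.isLeast.2 ⟨w, rfl⟩
  have hmid := h.mid_le
  have hleft := tailSum_le_tailSum h.left_le (w + 1)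
  have hright := tailSum_le_tailSum h.right_le (w.rev + 1)
  rw [window, window] at hge
  -- The segment leaves out one stack less than a window, so it contains one side of the window.
  have htail : tailSum Q.left i = tailSum P.left i ∨ tailSum Q.right j = tailSum P.right j := by
    rcases Nat.lt_or_ge w i with hwi | hwi
    · have := tailSum_add_tailSum_eq h.left_eq (s := w + 1) hwi
      omega
    · have := tailSum_add_tailSum_eq h.right_eq (s := w.rev + 1) (by rw [Fin.val_rev]; omega)
      omega
  obtain ⟨hleft, hright⟩ := h.rows_eq_of_tailSum_eq hP.sum_eq hQ.sum_eq htail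
  exact HalvedPosition.ext hleft (by omega) hright

theorem EndMove.window_eq (h : EndMove P Q) (i : Fin ℓ) : Q.window i = P.window i := by
  rw [window, window, h.mid_eq, tailSum_succ_congr h.left_eq, tailSum_succ_congr h.right_eq]

theorem EndMove.eq_of_isBalanced (h : EndMove P Q) (hP : P.IsBalanced) (hQ : Q.IsBalanced) :
    Q = P := by
  have hmin : Q.minEnd = P.minEnd :=
    hQ.isLeast.unique (by rw [funext h.window_eq]; exact hP.isLeast)
  have hends : Q.left 0 + P.right 0 = P.left 0 + Q.right 0 := by
    have := hP.sum_eq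
    have := hQ.sum_eq
    have := tailSum_succ_congr h.left_eq 0
    have := tailSum_succ_congr h.right_eq 0
    simp only [tailSum_zero, zero_add] at *
    omega
  have hle := h.left_le 0
  rw [minEnd, minEnd] at hmin
  ext x
  · rcases eq_or_ne x 0 with rfl | hx
    exacts [by omega, h.left_eq x hx]
  · exact h.mid_eq
  · rcases eq_or_ne x 0 with rfl | hx
    exacts [by omega, h.right_eq x hx]

theorem IsBalanced.eq_of_move (hP : P.IsBalanced) (hQ : Q.IsBalanced) : Move P Q → Q = P
  | .inl ⟨_, _, hij, h⟩ => h.eq_of_isBalanced hij hP hQ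
  | .inr h => h.eq_of_isBalanced hP hQ

end NoMove

section Existence

variable {i x y : Fin ℓ} {s t : ℕ}

theorem IsAdmissible.exists_isBalanced_of_tailSum_eq_zero (hP : P.IsAdmissible)
    (hleft : tailSum P.left (i + 1) = 0) (hright : tailSum P.right (i.rev + 1) = 0) (a b : ℕ) :
    ∃ Q, SegmentMove a b P Q ∧ Q.IsBalanced := by
  have hmid : P.minEnd ≤ P.mid := by
    simpa only [window, hleft, hright, add_zero] using hP.le_window i
  let Q : HalvedPosition ℓ := ⟨P.left, P.minEnd, P.right⟩
  have hQ : Q.IsAdmissible := ⟨hP.sum_eq, fun _ => Nat.le_add_right_of_le (Nat.le_add_right ..)⟩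
  refine ⟨Q, ⟨le_rfl, hmid, le_rfl, fun _ _ => rfl, fun _ _ => rfl⟩, hQ.isBalanced (i := i) ?_⟩
  rw [window, hleft, hright]
  exact le_rfl

theorem minEnd_removePair (hx : 0 < x) (hy : 0 < y) : (P.removePair x y).minEnd = P.minEnd := by
  simp only [minEnd, removePair, removeToken_of_ne hx.ne, removeToken_of_ne hy.ne]

theorem IsAdmissible.exists_crosses_of_lt_window (hP : P.IsAdmissible)
    (hlt : ∀ t, P.minEnd < P.window t) (hcross : Crosses P.left P.right i)
    (hpos : 0 < tailSum P.left (i + 1)) :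
    ∃ Q, SegmentMove (i + 1) i.rev P Q ∧ tailSum Q.left (i + 1) < tailSum P.left (i + 1) ∧
      (Q.IsBalanced ∨ Q.IsAdmissible ∧ Crosses Q.left Q.right i) := by
  have hi : 0 < P.right i.rev := hcross.pos_or_eq_zero.resolve_right hpos.ne'
  obtain ⟨x, hix, hx, hxi⟩ := exists_first_pos hpos
  replace hix : i < x := hix
  have hx0 : 0 < x := (Fin.zero_le i).trans_lt hix
  have hi0 : 0 < i.rev := (Fin.zero_le x.rev).trans_lt (Fin.rev_lt_rev.2 hix)
  have hleft : tailSum (removeToken P.left x) (i + 1) < tailSum P.left (i + 1) :=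
    Nat.lt_of_succ_le (tailSum_removeToken_of_le hx hix).le
  have hadm {y : Fin ℓ} (hiy : i.rev ≤ y) (hy : 0 < P.right y)
      (hge : ∀ t, P.minEnd ≤ (P.removePair x y).window t) : (P.removePair x y).IsAdmissible :=
    ⟨sum_eq_removePair hP.sum_eq hx hy, by rwa [minEnd_removePair hx0 (hi0.trans_le hiy)]⟩
  have hadm_rev := hadm le_rfl hi (le_window_removePair_rev hlt hx hxi hi)
  by_cases hattained : ∃ t, (P.removePair x i.rev).window t ≤ P.minEnd
  · obtain ⟨t, ht⟩ := hattained
    rw [← minEnd_removePair hx0 hi0] at ht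
    exact ⟨_, segmentMove_removePair hix le_rfl, hleft, .inl (hadm_rev.isBalanced ht)⟩
  push Not at hattained
  rcases Nat.eq_zero_or_pos (tailSum P.right (i.rev + 1)) with hzero | hpos'
  · exact ⟨_, segmentMove_removePair hix le_rfl, hleft,
      .inr ⟨hadm_rev, hcross.removeToken_rev hx hix hi hzero⟩⟩
  · obtain ⟨y, hiy, hy, -⟩ := exists_first_pos hpos'
    replace hiy : i.rev < y := hiy
    -- No window loses two tokens more with `y` than with `i.rev`.
    have hge (t : Fin ℓ) : P.minEnd ≤ (P.removePair x y).window t := by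
      have hwindow_rev := window_removePair hx hi t
      have hwindow := window_removePair hx hy t
      have hlt_rev := hattained t
      split_ifs at hwindow_rev hwindow <;> omega
    exact ⟨_, segmentMove_removePair hix hiy.le, hleft,
      .inr ⟨hadm hiy.le hy hge, hcross.removeToken_of_lt hx hix hy hiy⟩⟩

theorem IsAdmissible.exists_isBalanced_of_crosses (hP : P.IsAdmissible)
    (hcross : Crosses P.left P.right i) : ∃ Q, SegmentMove (i + 1) i.rev P Q ∧ Q.IsBalanced := by
  induction hN : tailSum P.left (i + 1) using Nat.strong_induction_on generalizing P with
  | h N ih =>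
    by_cases hattained : ∃ t, P.window t ≤ P.minEnd
    · exact hattained.elim fun t ht => ⟨P, .refl .., hP.isBalanced ht⟩
    push Not at hattained
    rcases Nat.eq_zero_or_pos N with hzero | hpos
    · have hleft := hN.trans hzero
      exact hP.exists_isBalanced_of_tailSum_eq_zero hleft
        (Nat.le_zero.1 (hleft ▸ hcross.tailSum_succ_le)) ..
    · obtain ⟨P', hPP', hlt, hbal | ⟨hadm, hcross'⟩⟩ :=
        hP.exists_crosses_of_lt_window hattained hcross (hN ▸ hpos)
      · exact ⟨P', hPP', hbal⟩
      · obtain ⟨Q, hP'Q, hbal⟩ := ih _ (hN ▸ hlt) hadm hcross' rfl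
        exact ⟨Q, hPP'.trans hP'Q, hbal⟩

theorem window_rev_zero_add_le {t : Fin ℓ} (hsum : tailSum P.left 0 = tailSum P.right 0)
    (ht : tailSum P.left 1 ≤ tailSum P.left (t + 1)) :
    P.window (Fin.rev 0) + P.right 0 ≤ P.window t + P.left 0 := by
  have hempty : tailSum P.left ((0 : Fin ℓ).rev + 1) = 0 :=
    tailSum_of_le _ (by rw [Fin.val_rev, Fin.val_zero]; omega)
  rw [tailSum_zero, tailSum_zero] at hsum
  rw [window, window, hempty, Fin.rev_rev, Fin.val_zero, zero_add]
  omega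

theorem IsAdmissible.exists_isBalanced_of_window_le (hP : P.IsAdmissible)
    (hi : P.window i ≤ min (P.left 0 + 1) (P.right 0)) :
    ∃ f : Fin ℓ → ℕ, f 0 ≤ P.left 0 + 1 ∧ (∀ x ≠ 0, f x ≤ P.left x) ∧
      IsBalanced ⟨f, P.mid, P.right⟩ := by
  by_cases hattained : ∃ t, P.window t ≤ P.minEnd
  · exact ⟨P.left, Nat.le_succ _, fun _ _ => le_rfl, hattained.elim fun _ => hP.isBalanced⟩
  push Not at hattained
  have hlt : P.left 0 < P.right 0 := by
    have := hattained i
    rw [minEnd] at this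
    omega
  rw [minEnd, min_eq_left hlt.le] at hattained
  obtain ⟨z, hz, hz_pos, hz_tail⟩ : ∃ z : Fin ℓ, 1 ≤ z.val ∧ 0 < P.left z ∧ _ :=
    exists_first_pos (by
      have := hP.sum_eq
      rw [tailSum_zero, tailSum_zero] at this
      omega)
  let Q : HalvedPosition ℓ := ⟨shiftToZero P.left z, P.mid, P.right⟩
  have hminEnd : Q.minEnd = P.left 0 + 1 := by
    rw [minEnd, show Q.left 0 = _ from shiftToZero_zero P.left z, min_eq_left hlt]
  have hwindow (t : Fin ℓ) : Q.window t + (if t + 1 ≤ z.val then 1 else 0) = P.window t := by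
    rw [window, window, ← tailSum_succ_shiftToZero hz_pos]
    simp only [Q]
    omega
  have hQ : Q.IsAdmissible := by
    refine ⟨(tailSum_shiftToZero_zero hz_pos hz).trans hP.sum_eq, fun t => ?_⟩
    have ht := hwindow t
    have hlt_t := hattained t
    have hlt_last := hattained (Fin.rev 0)
    split_ifs at ht with htz
    · have := window_rev_zero_add_le hP.sum_eq (hz_tail ▸ tailSum_antitone P.left htz)
      omega
    · omega
  have hQi : Q.window i ≤ Q.minEnd := by
    have := hwindow i
    omega
  exact ⟨_, (shiftToZero_zero ..).le, fun _ => shiftToZero_le P.left z, hQ.isBalanced hQi⟩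

/-- The number of tokens by which the left row exceeds the right row, `0` if it does not. -/
def surplus (P : HalvedPosition ℓ) : ℕ := tailSum P.left 0 - tailSum P.right 0

/-- The position `P` with the surplus of the left row over the right one taken away: `s` tokens
from the inner end of the left row and the others from its end stack. -/
def trimLeft (P : HalvedPosition ℓ) (s : ℕ) : HalvedPosition ℓ :=
  ⟨trimBoth P.left P.surplus s, P.mid, P.right⟩

theorem window_trimLeft (P : HalvedPosition ℓ) (s : ℕ) (t : Fin ℓ) :
    (P.trimLeft s).window t =
      P.mid + (tailSum P.left (t + 1) - s) + tailSum P.right (t.rev + 1) := by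
  rw [window]
  simp only [trimLeft, tailSum_trimBoth _ _ _ (Nat.succ_pos _)]

theorem trimLeft_left_le (P : HalvedPosition ℓ) (s : ℕ) : (P.trimLeft s).left ≤ P.left :=
  trimBoth_le P.left P.surplus s

theorem trimLeft_left_zero (P : HalvedPosition ℓ) (s : ℕ) :
    (P.trimLeft s).left 0 = P.left 0 - (P.surplus - s) :=
  trimBoth_zero P.left P.surplus s

theorem minEnd_trimLeft (P : HalvedPosition ℓ) (s : ℕ) :
    (P.trimLeft s).minEnd = min (P.left 0 - (P.surplus - s)) (P.right 0) :=
  congrArg (min · (P.right 0)) (P.trimLeft_left_zero s)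

theorem sum_eq_trimLeft (hle : tailSum P.right 0 ≤ tailSum P.left 0)
    (hlow : P.surplus - P.left 0 ≤ s) (hhigh : s ≤ min P.surplus (tailSum P.left 1)) :
    tailSum (P.trimLeft s).left 0 = tailSum (P.trimLeft s).right 0 := by
  have := tailSum_trimBoth_zero (f := P.left) (δ := P.surplus) (s := s)
    (by omega) (by omega) (by omega)
  simp only [trimLeft]
  rw [surplus] at *
  omega

theorem segmentMove_trimLeft {j : ℕ} (hpos : 0 < tailSum (P.trimLeft s).left t)
    (hs : min P.surplus (tailSum P.left 1) ≤ s) : SegmentMove t j P (P.trimLeft s) := by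
  refine ⟨trimLeft_left_le P s, le_rfl, le_rfl, fun x hx => ?_, fun _ _ => rfl⟩
  simp only [trimLeft, tailSum_trimBoth P.left _ s (Nat.zero_lt_of_lt hx)] at hpos
  have hanti := tailSum_antitone P.left (Nat.one_le_of_lt hx)
  exact trimBoth_eq (t := t) (by omega) (by omega) hx

theorem IsAdmissible.exists_move_isBalanced_of_trimLeft (hP : (P.trimLeft s).IsAdmissible)
    (hs : min P.surplus (tailSum P.left 1) ≤ s) : ∃ Q, Move P Q ∧ Q.IsBalanced := by
  obtain ⟨i, hcross⟩ := exists_crosses hP.sum_eq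
  by_cases hzero : tailSum (P.trimLeft s).left (i + 1) = 0 ∧
      tailSum (P.trimLeft s).right (i.rev + 1) = 0
  · obtain ⟨Q, hmove, hQ⟩ := hP.exists_isBalanced_of_tailSum_eq_zero hzero.1 hzero.2 0 ℓ
    have htrim : SegmentMove 0 ℓ P (P.trimLeft s) :=
      ⟨trimLeft_left_le P s, le_rfl, le_rfl, fun _ h => absurd h (Nat.not_lt_zero _),
        fun _ _ => rfl⟩
    exact ⟨Q, .inl ⟨0, ℓ, ℓ.zero_add, htrim.trans hmove⟩, hQ⟩
  rcases hcross with hcross | hcross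
  · have htrim : SegmentMove (i + 1) i.rev P (P.trimLeft s) := by
      refine segmentMove_trimLeft ?_ hs
      have := hcross.tailSum_succ_le
      omega
    obtain ⟨Q, hmove, hQ⟩ := hP.exists_isBalanced_of_crosses hcross
    exact ⟨Q, .inl ⟨i + 1, i.rev, by rw [Fin.val_rev]; omega, htrim.trans hmove⟩, hQ⟩
  · have htrim : SegmentMove i (i.rev + 1) P (P.trimLeft s) := by
      refine segmentMove_trimLeft ?_ hs
      have hle := hcross.tailSum_succ_le
      have hge := hcross.le_tailSum
      rw [Fin.rev_rev] at hle hge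
      have := tailSum_eq_add (P.trimLeft s).left i
      omega
    obtain ⟨Q, hmove, hQ⟩ := hP.swap.exists_isBalanced_of_crosses hcross
    rw [Fin.rev_rev] at hmove
    exact ⟨Q.swap, .inl ⟨i, i.rev + 1, by rw [Fin.val_rev]; omega, htrim.trans hmove.swap⟩,
      hQ.swap⟩

theorem IsAdmissible.exists_move_isBalanced_of_window_trimLeft_lt
    (hP : (P.trimLeft s).IsAdmissible) (hs : s < P.surplus)
    (hi : (P.trimLeft (s + 1)).window i < (P.trimLeft (s + 1)).minEnd) :
    ∃ Q, Move P Q ∧ Q.IsBalanced := by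
  rw [window_trimLeft, minEnd_trimLeft] at hi
  have hi' : (P.trimLeft s).window i ≤ min ((P.trimLeft s).left 0 + 1) (P.right 0) := by
    rw [window_trimLeft, trimLeft_left_zero]
    omega
  obtain ⟨f, hf0, hf, hQ⟩ := hP.exists_isBalanced_of_window_le hi'
  rw [trimLeft_left_zero] at hf0
  have hle : f ≤ P.left := fun x => by
    rcases eq_or_ne x 0 with rfl | hx
    · exact hf0.trans (by omega)
    · exact (hf x hx).trans (trimLeft_left_le P s x)
  have hmove : SegmentMove 0 ℓ P ⟨f, P.mid, P.right⟩ :=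
    ⟨hle, le_rfl, le_rfl, fun _ h => absurd h (Nat.not_lt_zero _), fun _ _ => rfl⟩
  exact ⟨_, .inl ⟨0, ℓ, ℓ.zero_add, hmove⟩, hQ⟩

theorem exists_endMove_isBalanced (hle : tailSum P.right 0 ≤ tailSum P.left 0)
    (hi : P.window i < min (P.left 0 - P.surplus) (P.right 0)) :
    ∃ Q, EndMove P Q ∧ Q.IsBalanced := by
  obtain ⟨w, hw⟩ := Finite.exists_min P.window
  obtain ⟨e, he⟩ := Nat.exists_eq_add_of_le ((hw i).trans hi.le)
  let Q : HalvedPosition ℓ :=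
    ⟨update P.left 0 (P.left 0 - P.surplus - e), P.mid, update P.right 0 (P.right 0 - e)⟩
  have hmove : EndMove P Q :=
    ⟨update_le_self_iff.2 (by omega), rfl, update_le_self_iff.2 (Nat.sub_le ..),
      fun _ hx => update_of_ne hx .., fun _ hx => update_of_ne hx ..⟩
  have hleft : Q.left 0 = P.left 0 - P.surplus - e := by
    simp only [Q, update_self]
  have hright : Q.right 0 = P.right 0 - e := by
    simp only [Q, update_self]
  have hminEnd : Q.minEnd = P.window w := by
    rw [minEnd, hleft, hright]
    omega
  have hQ : Q.IsAdmissible := by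
    refine ⟨?_, fun t => by rw [hminEnd, hmove.window_eq]; exact hw t⟩
    have htail_left := tailSum_succ_congr hmove.left_eq 0
    have htail_right := tailSum_succ_congr hmove.right_eq 0
    rw [zero_add] at htail_left htail_right
    have hsum_left := tailSum_zero P.left
    have hsum_right := tailSum_zero P.right
    rw [tailSum_zero, tailSum_zero, htail_left, htail_right, hleft, hright]
    rw [surplus] at *
    omega
  exact ⟨Q, hmove, hQ.isBalanced (i := w) (by rw [hminEnd, hmove.window_eq])⟩

theorem exists_move_isBalanced_of_le (hle : tailSum P.right 0 ≤ tailSum P.left 0) :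
    ∃ Q, Move P Q ∧ Q.IsBalanced := by
  have hsum := tailSum_zero P.left
  have hsurplus : P.surplus ≤ tailSum P.left 0 := Nat.sub_le ..
  by_contra! hnone
  -- As `s` grows, the trimmed position would stay admissible up to the largest possible `s`.
  have hadm : ∀ s, P.surplus - P.left 0 ≤ s → s ≤ min P.surplus (tailSum P.left 1) →
      (P.trimLeft s).IsAdmissible := by
    intro s hs
    induction s, hs using Nat.le_induction with
    | base =>
      refine fun hhigh => ⟨sum_eq_trimLeft hle le_rfl hhigh, fun t => ?_⟩
      by_contra! hlt
      rw [window_trimLeft, minEnd_trimLeft] at hlt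
      have hlt' : P.window t < min (P.left 0 - P.surplus) (P.right 0) := by
        rw [window]
        omega
      obtain ⟨Q, hmove, hQ⟩ := exists_endMove_isBalanced hle hlt'
      exact hnone Q (.inr hmove) hQ
    | succ s hs ih =>
      refine fun hhigh => ⟨sum_eq_trimLeft hle (by omega) hhigh, fun t => ?_⟩
      by_contra! hlt
      obtain ⟨Q, hmove, hQ⟩ := (ih (by omega)).exists_move_isBalanced_of_window_trimLeft_lt
        (by omega) hlt
      exact hnone Q hmove hQ
  obtain ⟨Q, hmove, hQ⟩ :=
    (hadm _ (by omega) le_rfl).exists_move_isBalanced_of_trimLeft le_rfl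
  exact hnone Q hmove hQ

theorem exists_move_isBalanced (P : HalvedPosition ℓ) : ∃ Q, Move P Q ∧ Q.IsBalanced := by
  rcases le_total (tailSum P.right 0) (tailSum P.left 0) with hle | hle
  · exact exists_move_isBalanced_of_le hle
  · obtain ⟨Q, hmove, hQ⟩ := exists_move_isBalanced_of_le (P := P.swap) hle
    exact ⟨Q.swap, hmove.swap, hQ.swap⟩

end Existence

end HalvedPosition

section Transfer

variable {n k ℓ : ℕ}

theorem mem_pathSegment {a b : ℕ} {v : Fin n} : v ∈ pathSegment n a b ↔ a ≤ v + 1 ∧ v + 1 ≤ b := by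
  simp only [pathSegment, mem_filter, mem_univ, true_and]

theorem mem_endVertices {v : Fin n} : v ∈ endVertices n ↔ v.val = 0 ∨ v + 1 = n := by
  simp only [endVertices, mem_filter, mem_univ, true_and, Nat.add_eq_right]

theorem segmentSum_add_segmentSum {a b c : ℕ} (p : Position n) (hab : a ≤ b + 1) (hbc : b ≤ c) :
    segmentSum p a b + segmentSum p (b + 1) c = segmentSum p a c := by
  rw [segmentSum, segmentSum, ← sum_union]
  · refine sum_congr (Finset.ext fun v => ?_) fun _ _ => rfl
    rw [mem_union, mem_pathSegment, mem_pathSegment, mem_pathSegment]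
    omega
  · refine disjoint_left.2 fun v hv hv' => ?_
    rw [mem_pathSegment] at hv hv'
    omega

/-- Vertex `x` counted from the first end of the path, for `x < ℓ`; the vertex at the same
distance from the last end is its `Fin.rev`. -/
def outerVertex (k : ℕ) (x : Fin ℓ) : Fin (k + ℓ) := x.castLE (Nat.le_add_left ℓ k)

theorem val_outerVertex (x : Fin ℓ) : (outerVertex k x).val = x := rfl

theorem val_rev_outerVertex (x : Fin ℓ) : (outerVertex k x).rev.val = k + ℓ - (x + 1) :=
  Fin.val_rev _

theorem outerVertex_injective : Injective (outerVertex k : Fin ℓ → Fin (k + ℓ)) :=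
  Fin.castLE_injective (Nat.le_add_left ℓ k)

theorem vertex_cases (v : Fin (k + ℓ)) :
    (∃ x, v = outerVertex k x) ∨ (∃ x, v = (outerVertex k x).rev) ∨
      v ∈ pathSegment (k + ℓ) (ℓ + 1) k := by
  by_cases hleft : v < ℓ
  · exact .inl ⟨⟨v, hleft⟩, rfl⟩
  by_cases hright : v.rev < ℓ
  · exact .inr (.inl ⟨⟨v.rev, hright⟩, (Fin.rev_rev v).symm⟩)
  · rw [Fin.val_rev] at hright
    exact .inr (.inr (mem_pathSegment.2 ⟨by omega, by omega⟩))

/-- The position cut into the rows of the `ℓ` outer stacks on either side and the `k - ℓ` stacks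
between them. -/
def halve (p : Position (k + ℓ)) : HalvedPosition ℓ where
  left x := p (outerVertex k x)
  mid := segmentSum p (ℓ + 1) k
  right x := p (outerVertex k x).rev

theorem tailSum_halve_left (p : Position (k + ℓ)) (t : ℕ) :
    tailSum (halve p).left t = segmentSum p (t + 1) ℓ := by
  refine sum_nbij (outerVertex k) (fun x hx => ?_) outerVertex_injective.injOn
    (fun v hv => ?_) fun _ _ => rfl
  · exact mem_pathSegment.2 ⟨Nat.succ_le_succ (mem_filter.1 hx).2, x.isLt⟩
  · obtain ⟨htv, hvℓ⟩ := mem_pathSegment.1 hv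
    exact ⟨⟨v, hvℓ⟩, mem_coe.2 (mem_filter.2 ⟨mem_univ _, Nat.le_of_succ_le_succ htv⟩), rfl⟩

theorem tailSum_halve_right {b t : ℕ} (p : Position (k + ℓ)) (hb : b + t = k + ℓ) :
    tailSum (halve p).right t = segmentSum p (k + 1) b := by
  refine sum_nbij (fun x => (outerVertex k x).rev) (fun x hx => ?_)
    (Fin.rev_injective.comp outerVertex_injective).injOn (fun v hv => ?_) fun _ _ => rfl
  · have := (mem_filter.1 hx).2
    rw [mem_pathSegment, val_rev_outerVertex]
    omega
  · have hv' := mem_pathSegment.1 (mem_coe.1 hv)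
    have hval := Fin.val_rev v
    refine ⟨⟨v.rev, by omega⟩, mem_coe.2 (mem_filter.2 ⟨mem_univ _, ?_⟩), Fin.rev_rev v⟩
    dsimp only
    omega

theorem window_halve (hℓk : ℓ ≤ k) (p : Position (k + ℓ)) (i : Fin ℓ) :
    (halve p).window i = segmentSum p (i + 2) (i + k) := by
  have hright : i + k + (i.rev + 1) = k + ℓ := by
    rw [Fin.val_rev]
    omega
  rw [HalvedPosition.window, tailSum_halve_left, tailSum_halve_right p hright,
    ← segmentSum_add_segmentSum p (a := i + 2) (b := k) (c := i + k) (by omega) (by omega),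
    ← segmentSum_add_segmentSum p (a := i + 2) (b := ℓ) (c := k) (by omega) hℓk]
  change segmentSum p (ℓ + 1) k + segmentSum p (i + 2) ℓ + segmentSum p (k + 1) (i + k) = _
  omega

theorem eq_on_middle {p q : Position (k + ℓ)} (hle : q ≤ p) (h : (halve q).mid = (halve p).mid) :
    ∀ v ∈ pathSegment (k + ℓ) (ℓ + 1) k, q v = p v :=
  (sum_eq_sum_iff_of_le fun v _ => hle v).1 h

theorem eq_of_halve_eq {p q : Position (k + ℓ)} (hle : q ≤ p) (h : halve q = halve p) : q = p := by
  funext v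
  rcases vertex_cases v with ⟨x, rfl⟩ | ⟨x, rfl⟩ | hv
  · exact congrFun (congrArg HalvedPosition.left h) x
  · exact congrFun (congrArg HalvedPosition.right h) x
  · exact eq_on_middle hle (congrArg HalvedPosition.mid h) v hv

theorem exists_le_sum_eq {ι : Type*} (s : Finset ι) (f : ι → ℕ) {m : ℕ} (h : m ≤ ∑ i ∈ s, f i) :
    ∃ g ≤ f, ∑ i ∈ s, g i = m := by
  classical
  induction s using Finset.induction_on generalizing m with
  | empty => exact ⟨f, le_rfl, by rw [sum_empty] at *; omega⟩
  | insert a s ha ih =>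
    rw [sum_insert ha] at h
    obtain ⟨g, hg, hsum⟩ := ih (m := m - f a) (by omega)
    refine ⟨update g a (min m (f a)), update_le_iff.2 ⟨min_le_right .., fun i _ => hg i⟩, ?_⟩
    rw [sum_insert ha, update_self, sum_update_of_notMem ha, hsum]
    omega

theorem exists_halve_eq (hℓk : ℓ ≤ k) (p : Position (k + ℓ)) {Q : HalvedPosition ℓ}
    (hleft : Q.left ≤ (halve p).left) (hmid : Q.mid ≤ (halve p).mid)
    (hright : Q.right ≤ (halve p).right) : ∃ q ≤ p, halve q = Q := by
  obtain ⟨g, hg, hsum⟩ := exists_le_sum_eq (pathSegment (k + ℓ) (ℓ + 1) k) p hmid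
  let q : Position (k + ℓ) := fun v =>
    if h : v < ℓ then Q.left ⟨v, h⟩ else if h : v.rev < ℓ then Q.right ⟨v.rev, h⟩ else g v
  have hq_left (x : Fin ℓ) : q (outerVertex k x) = Q.left x := dif_pos x.isLt
  have hq_right (x : Fin ℓ) : q (outerVertex k x).rev = Q.right x := by
    have hx : ¬ (outerVertex k x).rev < ℓ := by
      rw [val_rev_outerVertex]
      omega
    simp only [q, dif_neg hx, Fin.rev_rev]
    exact dif_pos x.isLt
  have hq_mid {v : Fin (k + ℓ)} (hv : v ∈ pathSegment (k + ℓ) (ℓ + 1) k) : q v = g v := by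
    rw [mem_pathSegment] at hv
    simp only [q]
    rw [dif_neg (by omega), dif_neg (by rw [Fin.val_rev]; omega)]
  refine ⟨q, fun v => ?_, HalvedPosition.ext (funext hq_left) ?_ (funext hq_right)⟩
  · rcases vertex_cases v with ⟨x, rfl⟩ | ⟨x, rfl⟩ | hv
    · exact (hq_left x).trans_le (hleft x)
    · exact (hq_right x).trans_le (hright x)
    · exact (hq_mid hv).trans_le (hg v)
  · exact (sum_congr rfl fun v hv => hq_mid hv).trans hsum

variable [NeZero ℓ] {p q : Position (k + ℓ)}

theorem move_halve_of_setNimMove (hℓk : ℓ ≤ k)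
    (h : SetNimMove (necklaceNim (k + ℓ) k) p q) : (halve p).Move (halve q) := by
  obtain ⟨A, hA, hle, hA_eq, -⟩ := h
  rcases hA with ⟨i, hi, hik, rfl⟩ | rfl
  · refine .inl ⟨i - 1, ℓ + 1 - i, by omega, fun _ => hle _,
      sum_le_sum (s := pathSegment (k + ℓ) (ℓ + 1) k) fun v _ => hle v, fun _ => hle _,
      fun x hx => hA_eq _ ?_, fun x hx => hA_eq _ ?_⟩
    · rw [mem_pathSegment, val_outerVertex]
      omega
    · rw [mem_pathSegment, val_rev_outerVertex]
      omega
  · have hℓ := NeZero.pos ℓ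
    refine .inr ⟨fun _ => hle _,
      sum_congr (s₁ := pathSegment (k + ℓ) (ℓ + 1) k) rfl fun v hv => hA_eq _ ?_, fun _ => hle _,
      fun x hx => hA_eq _ ?_, fun x hx => hA_eq _ ?_⟩
    · rw [mem_pathSegment] at hv
      rw [mem_endVertices]
      omega
    · have hx' := Fin.val_ne_zero_iff.2 hx
      rw [mem_endVertices, val_outerVertex]
      omega
    · have hx' := Fin.val_ne_zero_iff.2 hx
      rw [mem_endVertices, val_rev_outerVertex]
      omega

theorem setNimMove_of_move_halve (hℓk : ℓ ≤ k) (hle : q ≤ p) (hne : q ≠ p)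
    (h : (halve p).Move (halve q)) : SetNimMove (necklaceNim (k + ℓ) k) p q := by
  obtain ⟨v, hv⟩ := Function.ne_iff.1 hne
  have hlt : ∃ v, q v < p v := ⟨v, (hle v).lt_of_ne hv⟩
  rcases h with ⟨i, j, hij, h⟩ | h
  · refine ⟨_, .inl ⟨i + 1, by omega, by omega, rfl⟩, hle, fun v hv => ?_, hlt⟩
    rw [mem_pathSegment] at hv
    rcases vertex_cases v with ⟨x, rfl⟩ | ⟨x, rfl⟩ | hmid
    · rw [val_outerVertex] at hv
      exact h.left_eq x (by omega)
    · rw [val_rev_outerVertex] at hv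
      exact h.right_eq x (by omega)
    · rw [mem_pathSegment] at hmid
      omega
  · refine ⟨_, .inr rfl, hle, fun v hv => ?_, hlt⟩
    rw [mem_endVertices] at hv
    rcases vertex_cases v with ⟨x, rfl⟩ | ⟨x, rfl⟩ | hmid
    · refine h.left_eq x fun hx => hv (.inl ?_)
      rw [val_outerVertex, hx, Fin.val_zero]
    · refine h.right_eq x fun hx => hv (.inr ?_)
      rw [val_rev_outerVertex, hx, Fin.val_zero]
      omega
    · exact eq_on_middle hle h.mid_eq v hmid

end Transfer

section PPositions

theorem isPPosition_iff_mem {n : ℕ} {𝒜 : Set (Finset (Fin n))} {B : Set (Position n)}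
    (hstable : ∀ p ∈ B, ∀ q ∈ B, ¬ SetNimMove 𝒜 p q)
    (habsorbing : ∀ p ∉ B, ∃ q ∈ B, SetNimMove 𝒜 p q) (p : Position n) :
    IsPPosition 𝒜 p ↔ p ∈ B := by
  induction hp : ∑ v, p v using Nat.strong_induction_on generalizing p with
  | _ m ih =>
    subst hp
    rw [IsPPosition]
    constructor
    · intro h
      by_contra hp
      obtain ⟨q, hq, hpq⟩ := habsorbing p hp
      exact h q hpq ((ih _ hpq.sum_lt q rfl).2 hq)
    · exact fun hp q hpq hq => hstable p hp q ((ih _ hpq.sum_lt q rfl).1 hq) hpq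

variable {k ℓ : ℕ}

theorem isPPosition_iff_isBalanced_halve [NeZero ℓ] (hℓk : ℓ ≤ k) (p : Position (k + ℓ)) :
    IsPPosition (necklaceNim (k + ℓ) k) p ↔ (halve p).IsBalanced := by
  refine isPPosition_iff_mem (B := {p | (halve p).IsBalanced}) (fun p hp q hq hpq => ?_)
    (fun p hp => ?_) p
  · have hpq' := hp.eq_of_move hq (move_halve_of_setNimMove hℓk hpq)
    obtain ⟨_, _, hle, _, v, hv⟩ := hpq
    exact hv.ne (congrFun (eq_of_halve_eq hle hpq') v)
  · obtain ⟨Q, hmove, hQ⟩ := (halve p).exists_move_isBalanced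
    obtain ⟨q, hle, rfl⟩ := exists_halve_eq hℓk p hmove.left_le hmove.mid_le hmove.right_le
    exact ⟨q, hQ, setNimMove_of_move_halve hℓk hle (fun h => hp (h ▸ hQ)) hmove⟩

theorem isLeast_iff_eq_inf' {ι α : Type*} [LinearOrder α] {s : Finset ι} (hs : s.Nonempty)
    (f : ι → α) {a : α} : IsLeast (f '' s) a ↔ a = s.inf' hs f := by
  have hleast : IsLeast (f '' s) (s.inf' hs f) := by
    obtain ⟨i, hi, heq⟩ := exists_mem_eq_inf' hs f
    exact ⟨⟨i, hi, heq.symm⟩, Set.forall_mem_image.2 fun _ => inf'_le f⟩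
  exact ⟨fun h => h.unique hleast, fun h => h ▸ hleast⟩

theorem range_window_halve (hℓk : ℓ ≤ k) (p : Position (k + ℓ)) :
    Set.range (halve p).window =
      (fun i => segmentSum p i (i + k - 2)) '' (Icc 2 (ℓ + 1) : Finset ℕ) := by
  ext s
  simp only [Set.mem_range, Set.mem_image, coe_Icc, Set.mem_Icc, window_halve hℓk]
  constructor
  · rintro ⟨i, rfl⟩
    exact ⟨i + 2, by omega, by congr 1; omega⟩
  · rintro ⟨i, hi, rfl⟩
    exact ⟨⟨i - 2, by omega⟩, by congr 1 <;> dsimp only <;> omega⟩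

theorem minEnd_halve [NeZero ℓ] (hn : 3 ≤ k + ℓ) (p : Position (k + ℓ)) :
    (halve p).minEnd = min (firstStack hn p) (lastStack hn p) := rfl

theorem isBalanced_halve_iff [NeZero ℓ] (hn : 3 ≤ k + ℓ) (hℓk : ℓ ≤ k)
    (hwindow : (Icc 2 (ℓ + 1)).Nonempty) (p : Position (k + ℓ)) :
    (halve p).IsBalanced ↔
      segmentSum p 1 ℓ = segmentSum p (k + 1) (k + ℓ) ∧
        min (firstStack hn p) (lastStack hn p) =
          (Icc 2 (ℓ + 1)).inf' hwindow fun i => segmentSum p i (i + k - 2) := by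
  have hiff : (halve p).IsBalanced ↔ tailSum (halve p).left 0 = tailSum (halve p).right 0 ∧
      IsLeast (Set.range (halve p).window) (halve p).minEnd :=
    ⟨fun h => ⟨h.sum_eq, h.isLeast⟩, fun h => ⟨h.1, h.2⟩⟩
  rw [hiff, tailSum_halve_left, tailSum_halve_right p (add_zero _),
    range_window_halve hℓk, isLeast_iff_eq_inf' hwindow, minEnd_halve hn]

end PPositions

theorem mainTheorem3_general (n k ℓ : ℕ) (hn : 3 ≤ n) (hℓ : 1 ≤ ℓ) (hℓk : ℓ ≤ k)
    (hnk : n = k + ℓ) :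
    {p : Position n | IsPPosition (necklaceNim n k) p} =
      {p : Position n |
        segmentSum p 1 ℓ = segmentSum p (k + 1) n ∧
        min (firstStack hn p) (lastStack hn p) =
          (Icc 2 (ℓ + 1)).inf' (nonempty_Icc.2 (Nat.succ_le_succ hℓ))
            (fun i => segmentSum p i (i + k - 2))} := by
  subst hnk
  have : NeZero ℓ := ⟨by omega⟩
  ext p
  exact (isPPosition_iff_isBalanced_halve hℓk p).trans (isBalanced_halve_iff hn hℓk _ p)

/-- Here `n / 2` and `(n + 1) / 2` are quotients of natural numbers, that is, the floor and the
ceiling of half of `n`. -/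
theorem mainTheorem3 (n k ℓ : ℕ) (hn : 3 ≤ n) (hℓ : ℓ = n / 2) (hk : k = (n + 1) / 2) :
    {p : Position n | IsPPosition (necklaceNim n k) p} =
      {p : Position n |
        segmentSum p 1 ℓ = segmentSum p (k + 1) n ∧
        min (firstStack hn p) (lastStack hn p) =
          (Finset.Icc 2 (ℓ + 1)).inf' (windowIndices_nonempty hn hℓ)
            (fun i => segmentSum p i (i + k - 2))} :=
  mainTheorem3_general n k ℓ hn (by omega) (by omega) (by omega)
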